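/- Let $\mathcal{H}$ be an infinite-dimensional separable complex Hilbert space, let $\mathcal{B}(\mathcal{H})$ and $\mathcal{K}(\mathcal{H})$ be the algebras of bounded and of compact operators on $\mathcal{H}$, let $\mathcal{Q}(\mathcal{H})=\mathcal{B}(\mathcal{H})/\mathcal{K}(\mathcal{H})$ be the Calkin algebra, and let $\pi\colon\mathcal{B}(\mathcal{H})\to\mathcal{Q}(\mathcal{H})$ be the quotient map. Fix a faithful unital $^*$-representation $\gamma\colon\mathcal{Q}(\mathcal{H})\to\mathcal{B}(\mathbb{H})$ on a Hilbert space $\mathbb{H}$. Let $(q(t))_{t\ge 0}\subset\mathcal{Q}(\mathcal{H})$ be a $C_0$-semigroup of normal elements, that is, let every $q(t)$ be normal and let $T(t):=\gamma(q(t))$, $t\geq 0$, be a $C_0$-semigroup (strongly continuous one-parameter semigroup) on $\mathbb{H}$. More generally, it suffices that $(q(t))$ is given for nonnegative dyadic rationals $t$ only and that there is a $C_0$-semigroup $(T(t))_{t\ge 0}$ of normal operators on $\mathbb{H}$ with $T(t)=\gamma(q(t))$ for all nonnegative dyadic rationals $t$. In both cases let $A$ be the infinitesimal generator of $(T(t))_{t\ge0}$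 and $\sigma(A)$ its spectrum. Let $$\mathcal{A}_0=\mathrm{C}^*\big(\{1\}\cup\{q(2^{-n})\colon n=0,1,2,\ldots\}\big)\subset\mathcal{Q}(\mathcal{H}),\qquad \mathcal{E}=\pi^{-1}(\mathcal{A}_0)\subset\mathcal{B}(\mathcal{H}).$$ Then $\mathcal{E}$ is the $\mathrm{C}^*$-subalgebra of $\mathcal{B}(\mathcal{H})$ generated by all operators $S$ with $\pi(S)\in\{1\}\cup\{q(2^{-n})\colon n=0,1,2,\ldots\}$, and the following hold. (a) $\mathcal{A}_0$ is a commutative $\mathrm{C}^*$-algebra, and its maximal ideal space $\Delta$ (the space of characters with the weak$^*$ topology) is homeomorphic to the inverse limit $$\varprojlim\{\Omega_n,p_n\}=\Big\{(x_n)_{n\ge 0}\in\prod_{n\ge 0}\Omega_n\colon p_n(x_{n+1})=x_n \text{ for all } n\geq 0\Big\}$$ with the topology induced from the product, where $\Omega_n=\overline{\{\exp(2^{-n}z)\colon z\in\sigma(A)\}}\subset\mathbb{C}$ and $p_n\colon\Omega_{n+1}\to\Omega_n$, $p_n(z)=z^2$. (b) $\mathcal{E}$ contains $\mathcal{K}(\mathcal{H})$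 as a two-sided ideal, and there is an exact sequence of $^*$-homomorphisms $$0\longrightarrow\mathcal{K}(\mathcal{H})\xrightarrow{\ \iota\ }\mathcal{E}\xrightarrow{\ \theta\ }C(\Delta)\longrightarrow 0,$$ where $\iota$ is the inclusion and $\theta(S)=\widehat{\pi(S)}$, with $\mathcal{A}_0\ni a\mapsto\widehat{a}\in C(\Delta)$ the Gelfand transform. -/

import Mathlib

open Filter Topology Set WeakDual
open scoped NNReal InnerProductSpace

noncomputable section

/-! ## Compact operators and the Calkin algebra -/

section Calkin

variable (H : Type*) [NormedAddCommGroup H] [InnerProductSpace ℂ H] [CompleteSpace H]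

/-- A compact operator is approximated in norm by its compressions to finite-dimensional
subspaces of the range. -/
theorem exists_starProjection_comp_near {H : Type*} [NormedAddCommGroup H]
    [InnerProductSpace ℂ H] [CompleteSpace H] {T : H →L[ℂ] H} (hT : IsCompactOperator T)
    {ε : ℝ} (hε : 0 < ε) :
    ∃ P : H →L[ℂ] H, IsCompactOperator P ∧ IsSelfAdjoint P ∧ ‖1 - P‖ ≤ 1 ∧ ‖T - P * T‖ ≤ ε := by
  have hK := (hT.isCompact_closure_image_closedBall (f := (T : H →ₗ[ℂ] H)) 1).totallyBounded
  obtain ⟨t, htf, ht⟩ := Metric.totallyBounded_iff.1 hK ε hε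
  let V : Submodule ℂ H := Submodule.span ℂ t
  have : FiniteDimensional ℂ V := FiniteDimensional.span_of_finite ℂ htf
  have hmin : ∀ (y v : H), v ∈ V → ‖y - V.starProjection y‖ ≤ ‖y - v‖ := by
    intro y v hv
    rw [V.starProjection_minimal y]
    exact ciInf_le (f := fun x : V => ‖y - x‖) ⟨0, by rintro _ ⟨x, rfl⟩; exact norm_nonneg _⟩
      ⟨v, hv⟩
  refine ⟨V.starProjection, ?_, isSelfAdjoint_starProjection V, ?_, ?_⟩
  · have h1 : IsCompactOperator (V.orthogonalProjectionOnto : H → V) :=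
      isCompactOperator_of_locallyCompactSpace_dom V.orthogonalProjectionOnto
    exact h1.clm_comp V.subtypeL
  · refine ContinuousLinearMap.opNorm_le_bound _ zero_le_one fun x => ?_
    simpa using hmin x 0 V.zero_mem
  · refine ContinuousLinearMap.opNorm_le_of_unit_norm hε.le fun x hx => ?_
    have hx' : T x ∈ closure ((T : H →ₗ[ℂ] H) '' Metric.closedBall 0 1) :=
      subset_closure ⟨x, by simp [hx], rfl⟩
    obtain ⟨y, hy, hxy⟩ := mem_iUnion₂.1 (ht hx')
    have := hmin (T x) y (Submodule.subset_span hy)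
    rw [Metric.mem_ball, dist_eq_norm] at hxy
    simpa using this.trans hxy.le

/-- The adjoint of a compact operator is compact. -/
theorem isCompactOperator_star {H : Type*} [NormedAddCommGroup H]
    [InnerProductSpace ℂ H] [CompleteSpace H] {T : H →L[ℂ] H} (hT : IsCompactOperator T) :
    IsCompactOperator (star T : H →L[ℂ] H) := by
  have hcl : IsClosed {S : H →L[ℂ] H | IsCompactOperator S} :=
    isClosed_setOfPred_isCompactOperator
  have : star T ∈ closure {S : H →L[ℂ] H | IsCompactOperator S} := by
    refine Metric.mem_closure_iff.2 fun ε hε => ?_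
    obtain ⟨P, hP, hPs, -, hPT⟩ := exists_starProjection_comp_near hT (half_pos hε)
    refine ⟨star T * P, hP.clm_comp (star T), ?_⟩
    have h1 : star T - star T * P = star (T - P * T) := by
      rw [star_sub, star_mul, hPs.star_eq]
    rw [dist_eq_norm, h1, norm_star]
    linarith
  rwa [hcl.closure_eq] at this

/-- `𝒦(H)`: the compact operators, as a (non-unital) star-subalgebra of `ℬ(H)`. -/
def compactOps : NonUnitalStarSubalgebra ℂ (H →L[ℂ] H) where
  carrier := {T | IsCompactOperator T}
  add_mem' hS hT := hS.add hT
  zero_mem' := isCompactOperator_zero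
  mul_mem' {S _} _ hT := hT.clm_comp S
  smul_mem' c _ hT := hT.smul c
  star_mem' hT := isCompactOperator_star hT

/-- `𝒦(H)` as an ideal of `ℬ(H)`. -/
def compactIdeal : Ideal (H →L[ℂ] H) where
  carrier := {T | IsCompactOperator T}
  add_mem' hS hT := hS.add hT
  zero_mem' := isCompactOperator_zero
  smul_mem' S _ hT := hT.clm_comp S

instance compactIdeal_isTwoSided : (compactIdeal H).IsTwoSided where
  mul_mem_of_left {_} S hT := hT.comp_clm S

instance compactIdeal_isClosed : IsClosed (compactIdeal H : Set (H →L[ℂ] H)) :=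
  isClosed_setOfPred_isCompactOperator

/-- The Calkin algebra `𝒬(H) = ℬ(H) / 𝒦(H)`. -/
def Calkin : Type _ := (H →L[ℂ] H) ⧸ compactIdeal H

namespace Calkin

theorem quotient_norm_mul_le (x y : (H →L[ℂ] H) ⧸ compactIdeal H) : ‖x * y‖ ≤ ‖x‖ * ‖y‖ := by
  have key : ∀ ε > 0, ‖x * y‖ ≤ (‖x‖ + ε) * (‖y‖ + ε) := by
    intro ε hε
    obtain ⟨S, rfl, hS⟩ := Submodule.Quotient.norm_mk_lt x hε
    obtain ⟨T, rfl, hT⟩ := Submodule.Quotient.norm_mk_lt y hε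
    calc _ ≤ ‖S * T‖ := Submodule.Quotient.norm_mk_le (compactIdeal H) (S * T)
      _ ≤ ‖S‖ * ‖T‖ := norm_mul_le _ _
      _ ≤ _ := by gcongr
  have h0 : Tendsto (fun ε : ℝ => (‖x‖ + ε) * (‖y‖ + ε)) (𝓝[>] 0) (𝓝 (‖x‖ * ‖y‖)) := by
    have : Continuous fun ε : ℝ => (‖x‖ + ε) * (‖y‖ + ε) := by fun_prop
    simpa using (this.tendsto 0).mono_left nhdsWithin_le_nhds
  exact ge_of_tendsto h0 (eventually_nhdsWithin_of_forall key)

theorem quotient_norm_smul_le (c : ℂ) (x : (H →L[ℂ] H) ⧸ compactIdeal H) :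
    ‖c • x‖ ≤ ‖c‖ * ‖x‖ := by
  refine le_of_forall_pos_le_add fun ε hε => ?_
  obtain ⟨T, rfl, hT⟩ := Submodule.Quotient.norm_mk_lt x (ε := ε / (‖c‖ + 1)) (by positivity)
  calc _ ≤ ‖c • T‖ := Submodule.Quotient.norm_mk_le (compactIdeal H) (c • T)
    _ ≤ ‖c‖ * ‖T‖ := norm_smul_le _ _
    _ ≤ ‖c‖ * (‖Submodule.Quotient.mk (p := compactIdeal H) T‖ + ε / (‖c‖ + 1)) := by gcongr
    _ ≤ _ := by
      rw [mul_add]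
      gcongr
      rw [mul_div_assoc', div_le_iff₀ (by positivity)]
      nlinarith [norm_nonneg c]

instance instRing : Ring (Calkin H) :=
  inferInstanceAs (Ring ((H →L[ℂ] H) ⧸ compactIdeal H))

instance instAlgebra : Algebra ℂ (Calkin H) :=
  inferInstanceAs (Algebra ℂ ((H →L[ℂ] H) ⧸ compactIdeal H))

/-- The quotient norm. -/
instance instNormedAddCommGroup : NormedAddCommGroup (Calkin H) :=
  inferInstanceAs (NormedAddCommGroup ((H →L[ℂ] H) ⧸ compactIdeal H))

instance instNormedRing : NormedRing (Calkin H) :=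
  { instRing H, instNormedAddCommGroup H with
    norm_mul_le := quotient_norm_mul_le H }

instance instNormedAlgebra : NormedAlgebra ℂ (Calkin H) :=
  { instAlgebra H with
    norm_smul_le := quotient_norm_smul_le H }

instance instCompleteSpace : CompleteSpace (Calkin H) :=
  inferInstanceAs (CompleteSpace ((H →L[ℂ] H) ⧸ compactIdeal H))

/-- The quotient map as a homomorphism of algebras. -/
def mkAlg : (H →L[ℂ] H) →ₐ[ℂ] Calkin H := Ideal.Quotient.mkₐ ℂ (compactIdeal H)

variable {H}

theorem mkAlg_surjective : Function.Surjective (mkAlg H) := Ideal.Quotient.mk_surjective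

theorem mkAlg_eq_zero {T : H →L[ℂ] H} : mkAlg H T = 0 ↔ IsCompactOperator T :=
  Ideal.Quotient.eq_zero_iff_mem (I := compactIdeal H)

theorem mkAlg_eq {S T : H →L[ℂ] H} : mkAlg H S = mkAlg H T ↔ IsCompactOperator (S - T) := by
  rw [← sub_eq_zero, ← map_sub, mkAlg_eq_zero]

theorem norm_mkAlg_le (T : H →L[ℂ] H) : ‖mkAlg H T‖ ≤ ‖T‖ :=
  Submodule.Quotient.norm_mk_le (compactIdeal H) T

theorem exists_norm_lt (x : Calkin H) {ε : ℝ} (hε : 0 < ε) :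
    ∃ T : H →L[ℂ] H, mkAlg H T = x ∧ ‖T‖ < ‖x‖ + ε :=
  Submodule.Quotient.norm_mk_lt (S := compactIdeal H) x hε

instance instStar : Star (Calkin H) where
  star := Quotient.lift (fun T => mkAlg H (star T)) fun S T h => by
    have h' : mkAlg H S = mkAlg H T := Quotient.sound h
    rw [mkAlg_eq] at h' ⊢
    have := isCompactOperator_star h'
    rwa [star_sub] at this

theorem star_mkAlg (T : H →L[ℂ] H) : star (mkAlg H T) = mkAlg H (star T) := rfl

instance instStarRing : StarRing (Calkin H) where
  star_involutive x := by
    obtain ⟨T, rfl⟩ := mkAlg_surjective x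
    simp [star_mkAlg]
  star_mul x y := by
    obtain ⟨S, rfl⟩ := mkAlg_surjective x
    obtain ⟨T, rfl⟩ := mkAlg_surjective y
    simp only [star_mkAlg, ← map_mul, star_mul]
  star_add x y := by
    obtain ⟨S, rfl⟩ := mkAlg_surjective x
    obtain ⟨T, rfl⟩ := mkAlg_surjective y
    simp only [star_mkAlg, ← map_add, star_add]

instance instStarModule : StarModule ℂ (Calkin H) where
  star_smul c x := by
    obtain ⟨T, rfl⟩ := mkAlg_surjective x
    simp only [star_mkAlg, ← map_smul, star_smul]

instance instCStarRing : CStarRing (Calkin H) where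
  norm_mul_self_le x := by
    refine le_of_forall_pos_le_add fun ε hε => ?_
    obtain ⟨T, rfl⟩ := mkAlg_surjective x
    obtain ⟨S, hS, hSn⟩ := exists_norm_lt (star (mkAlg H T) * mkAlg H T) (half_pos hε)
    rw [star_mkAlg, ← map_mul, mkAlg_eq] at hS
    -- `S = T⋆T + K` with `K` compact
    obtain ⟨P, hP, hPs, hP1, hPK⟩ := exists_starProjection_comp_near hS (half_pos hε)
    set Q : H →L[ℂ] H := 1 - P with hQ
    have hQs : star Q = Q := by rw [hQ, star_sub, star_one, hPs.star_eq]
    have hTQ : mkAlg H T = mkAlg H (T * Q) := by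
      rw [mkAlg_eq]
      have : T - T * Q = T * P := by rw [hQ]; noncomm_ring
      have h2 : IsCompactOperator (T * P : H →L[ℂ] H) := hP.clm_comp T
      rw [← this] at h2
      exact h2
    have hdec : star (T * Q) * (T * Q) = Q * S * Q - (S - star T * T - P * (S - star T * T)) * Q := by
      rw [star_mul, hQs, hQ]; noncomm_ring
    calc ‖mkAlg H T‖ * ‖mkAlg H T‖ ≤ ‖T * Q‖ * ‖T * Q‖ := by
          rw [hTQ]; gcongr <;> exact norm_mkAlg_le _
      _ = ‖star (T * Q) * (T * Q)‖ := CStarRing.norm_star_mul_self.symm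
      _ ≤ ‖Q * S * Q‖ + ‖(S - star T * T - P * (S - star T * T)) * Q‖ := by
          rw [hdec]; exact norm_sub_le _ _
      _ ≤ 1 * ‖S‖ * 1 + ε / 2 * 1 := by
          gcongr
          · refine (norm_mul_le _ _).trans ?_
            gcongr
            refine (norm_mul_le _ _).trans ?_
            gcongr
          · refine (norm_mul_le _ _).trans ?_
            gcongr
      _ ≤ _ := by linarith

/-- The Calkin algebra, with the quotient norm, is a C⋆-algebra. -/
instance instCStarAlgebra : CStarAlgebra (Calkin H) where

variable (H)

/-- The canonical quotient map `π : ℬ(H) → 𝒬(H)`. -/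
def mk : (H →L[ℂ] H) →⋆ₐ[ℂ] Calkin H :=
  { mkAlg H with map_star' := fun T => (star_mkAlg T).symm }

end Calkin

end Calkin

/-! ## C⋆-subalgebras generated by a set -/

/-- `C⋆(S)`: the smallest closed star-subalgebra that contains `1` and `S`. -/
def cstarGenerated {A : Type*} [CStarAlgebra A] (S : Set A) : StarSubalgebra ℂ A :=
  (StarAlgebra.adjoin ℂ S).topologicalClosure

/-! ## Semigroups of operators, their generators, and spectra of unbounded operators -/

section Semigroup

variable {X : Type*} [NormedAddCommGroup X] [NormedSpace ℂ X]

/-- `(T(t))_{t ≥ 0}` is a `C₀`-semigroup (a strongly continuous one-parameter semigroup). -/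
structure IsC0Semigroup (T : ℝ≥0 → X →L[ℂ] X) : Prop where
  map_zero : T 0 = 1
  map_add : ∀ s t, T (s + t) = T s * T t
  continuous_orbit : ∀ x, Continuous fun t => T t x

/-- The graph of the infinitesimal generator of `(T(t))_{t ≥ 0}`: the pairs `(x, y)` with
`y = lim_{h → 0+} (T(h) x - x) / h`. -/
def generatorGraph (T : ℝ≥0 → X →L[ℂ] X) : Submodule ℂ (X × X) where
  carrier := {p | Tendsto (fun h : ℝ≥0 => ((h : ℝ) : ℂ)⁻¹ • (T h p.1 - p.1)) (𝓝[>] 0) (𝓝 p.2)}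
  add_mem' {p q} hp hq := by
    refine (Tendsto.add hp hq).congr fun h => ?_
    simp only [Prod.fst_add, map_add, ← smul_add]
    congr 1; abel
  zero_mem' := by simp
  smul_mem' c p hp := by
    refine (Tendsto.const_smul hp c).congr fun h => ?_
    simp only [Prod.smul_fst, map_smul, ← smul_sub]
    rw [smul_comm]

theorem generatorGraph_snd_eq_zero (T : ℝ≥0 → X →L[ℂ] X) (p : X × X)
    (hp : p ∈ generatorGraph T) (h0 : p.1 = 0) : p.2 = 0 := by
  have hp' : Tendsto (fun h : ℝ≥0 => ((h : ℝ) : ℂ)⁻¹ • (T h p.1 - p.1)) (𝓝[>] 0) (𝓝 p.2) := hp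
  simp only [h0, map_zero, sub_zero, smul_zero] at hp'
  exact tendsto_nhds_unique hp' tendsto_const_nhds

/-- The infinitesimal generator, as a partially defined (unbounded) operator: its domain consists
of all `x` for which `A x = lim_{h → 0+} (T(h) x - x) / h` exists. -/
def generator (T : ℝ≥0 → X →L[ℂ] X) : X →ₗ.[ℂ] X := (generatorGraph T).toLinearPMap

theorem mem_generator_graph (T : ℝ≥0 → X →L[ℂ] X) (x y : X) :
    (x, y) ∈ (generator T).graph ↔
      Tendsto (fun h : ℝ≥0 => ((h : ℝ) : ℂ)⁻¹ • (T h x - x)) (𝓝[>] 0) (𝓝 y) := by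
  rw [generator, Submodule.toLinearPMap_graph_eq _ (generatorGraph_snd_eq_zero T)]
  rfl

/-- `R` is a bounded inverse of `z - A : D(A) → X`. -/
def IsResolventAt (A : X →ₗ.[ℂ] X) (z : ℂ) (R : X →L[ℂ] X) : Prop :=
  (∀ x : A.domain, R (z • (x : X) - A x) = x) ∧
    ∀ y : X, ∃ x : A.domain, (x : X) = R y ∧ z • (x : X) - A x = y

/-- The spectrum `σ(A)` of an unbounded operator: all `z` for which `z - A : D(A) → X` has no
bounded inverse. -/
def unboundedSpectrum (A : X →ₗ.[ℂ] X) : Set ℂ := {z | ¬ ∃ R : X →L[ℂ] X, IsResolventAt A z R}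

end Semigroup

/-- The nonnegative dyadic rationals `k 2^{-m}`. -/
def dyadicTimes : Set ℝ≥0 := {t | ∃ k m : ℕ, t = k / 2 ^ m}

/-! ## The inverse system -/

/-- The inverse limit of a sequence of spaces `X n` and maps `f n : X (n + 1) → X n`, with the
topology induced from the product. -/
abbrev InverseLimit (X : ℕ → Type*) (f : ∀ n, X (n + 1) → X n) : Type _ :=
  {x : ∀ n, X n // ∀ n, f n (x (n + 1)) = x n}

/-- `Ω_n`, the closure of `exp(2^{-n} S)`. -/
def expClosure (S : Set ℂ) (n : ℕ) : Set ℂ := closure ((fun z => Complex.exp (z / 2 ^ n)) '' S)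

theorem mapsTo_sq_expClosure (S : Set ℂ) (n : ℕ) :
    MapsTo (fun z : ℂ => z ^ 2) (expClosure S (n + 1)) (expClosure S n) := by
  refine MapsTo.closure ?_ (by fun_prop)
  rintro _ ⟨z, hz, rfl⟩
  refine ⟨z, hz, ?_⟩
  simp only [← Complex.exp_nat_mul]
  congr 1
  push_cast
  field_simp
  ring

/-- The connecting map `p_n : Ω_{n+1} → Ω_n`, `p_n(z) = z²`. -/
def sqMap (S : Set ℂ) (n : ℕ) : expClosure S (n + 1) → expClosure S n :=
  (mapsTo_sq_expClosure S n).restrict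

end

/-!
The heart of the matter is the spectral mapping theorem
`σ(T(t)) = closure {e^{tz} | z ∈ σ(A)}` for a `C₀`-semigroup of normal operators
(`IsC0Semigroup.spectrum_eq_closure_exp`). It is proved with Gelfand theory in place of the spectral
theorem for unbounded normal operators.

* One inclusion holds for all `C₀`-semigroups (`IsC0Semigroup.exp_mem_spectrum`): an inverse of
  `1 - e^{-zt} T(t)`, composed with `∫₀ᵗ e^{-zs} T(s) ds`, is a bounded inverse of `z - A`.
* For the other, let `C` be the bicommutant of the semigroup. By Fuglede's theorem it is a
  commutative `C⋆`-algebra, and it contains the integrated orbits `V_r = ∫₀^r T(s) ds`. Although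
  `s ↦ T(s)` need not be norm continuous, `s ↦ T(s) V_r` is. So a character `χ` with `χ(V_r) ≠ 0`
  satisfies `χ(T(s)) = e^{sz}` for some `z`, and a peak argument shows `z ∈ σ(A)`
  (`IsC0Semigroup.exists_mem_unboundedSpectrum_character`). Since `h⁻¹ V_h → 1` strongly, these
  characters are dense, and their values at `T(t)` are dense in `σ(T(t))`
  (`IsC0Semigroup.spectrum_subset_of_commCStarAlgebra`).

As `γ` preserves spectra, the spectrum of `q(2^{-n})` in `𝒜₀` is `Ω_n`. The map
`χ ↦ (χ(q(2^{-n})))_n` from the character space to the inverse limit is injective because the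
`q(2^{-n})` generate `𝒜₀`. It is surjective by compactness: the characters with a prescribed value
at `q(2^{-n})` form a nonempty closed set, and this set shrinks with `n` because
`q(2^{-n-1})² = q(2^{-n})` (`nonempty_homeomorph_inverseLimit`).

The exact sequence is the restriction of `0 → 𝒦(H) → ℬ(H) → 𝒬(H) → 0` to `ℰ = π⁻¹(𝒜₀)`, followed by
the Gelfand isomorphism `𝒜₀ ≃ C(Δ)`. That `ℰ` is generated by the lifts of the generators
(`comap_mk_cstarGenerated`) holds because each compact operator is a difference of two lifts of `1`.
-/

/-! ### The generator of a `C₀`-semigroup: commutation, rescaling and resolvents -/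

section SemigroupCalculus

variable {X : Type*} [NormedAddCommGroup X] [NormedSpace ℂ X] {T : ℝ≥0 → X →L[ℂ] X}

/-- Difference quotients over small positive times, with the times in `ℝ≥0`. -/
theorem HasDerivAt.tendsto_slope_nnreal {f : ℝ → X} {f' : X} {r : ℝ}
    (hf : HasDerivAt f f' r) :
    Tendsto (fun h : ℝ≥0 => ((h : ℝ) : ℂ)⁻¹ • (f (r + h) - f r)) (𝓝[>] 0) (𝓝 f') := by
  have h1 : Tendsto ((↑) : ℝ≥0 → ℝ) (𝓝[>] 0) (𝓝[>] 0) := by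
    refine tendsto_nhdsWithin_iff.2 ⟨?_, ?_⟩
    · exact (NNReal.continuous_coe.tendsto 0).mono_left nhdsWithin_le_nhds
    · exact eventually_nhdsWithin_of_forall fun h hh => NNReal.coe_pos.2 hh
  refine (hf.tendsto_slope_zero_right.comp h1).congr fun h => ?_
  rw [Function.comp_apply, ← Complex.ofReal_inv, Complex.coe_smul]

theorem IsC0Semigroup.commute (hT : IsC0Semigroup T) (s t : ℝ≥0) : Commute (T s) (T t) := by
  rw [Commute, SemiconjBy, ← hT.map_add, ← hT.map_add, add_comm]

theorem IsC0Semigroup.pow_eq (hT : IsC0Semigroup T) (t : ℝ≥0) (n : ℕ) : T t ^ n = T (n * t) := by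
  induction n with
  | zero => simp [hT.map_zero]
  | succ n ih => rw [pow_succ, ih, ← hT.map_add, Nat.cast_succ, add_mul, one_mul]

theorem IsC0Semigroup.continuous_orbit_toNNReal (hT : IsC0Semigroup T) (x : X) :
    Continuous fun s : ℝ => T s.toNNReal x :=
  (hT.continuous_orbit x).comp continuous_real_toNNReal

theorem generatorGraph_map_mem {B : X →L[ℂ] X} (hB : ∀ s, Commute B (T s)) {x y : X}
    (hxy : (x, y) ∈ generatorGraph T) : (B x, B y) ∈ generatorGraph T := by
  refine ((B.continuous.tendsto y).comp hxy).congr fun h => ?_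
  have := congr($((hB h).eq) x)
  simp only [mul_apply_eq_comp] at this
  simp [this]

/-- The rescaled semigroup `e^{-zs} T(s)`, whose generator is `A - z`. -/
noncomputable def rescaledSemigroup (T : ℝ≥0 → X →L[ℂ] X) (z : ℂ) (s : ℝ≥0) : X →L[ℂ] X :=
  Complex.exp (-((s : ℝ) * z)) • T s

theorem IsC0Semigroup.rescaled (hT : IsC0Semigroup T) (z : ℂ) :
    IsC0Semigroup (rescaledSemigroup T z) where
  map_zero := by simp [rescaledSemigroup, hT.map_zero]
  map_add s t := by
    simp only [rescaledSemigroup, hT.map_add, smul_mul_smul_comm, ← Complex.exp_add]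
    congr 2
    push_cast
    ring
  continuous_orbit x := by
    have := hT.continuous_orbit x
    simp only [rescaledSemigroup, smul_apply]
    fun_prop

theorem generatorGraph_of_rescaled {z : ℂ} {x y : X}
    (h : (x, y) ∈ generatorGraph (rescaledSemigroup T z)) :
    (x, z • x + y) ∈ generatorGraph T := by
  have hd : HasDerivAt (fun s : ℝ => Complex.exp (s * z)) z 0 := by
    have := ((Complex.ofRealCLM.hasDerivAt (x := (0 : ℝ))).mul_const z).cexp
    simpa using this
  have h1 := hd.tendsto_slope_nnreal
  have hc : Tendsto (fun h : ℝ≥0 => Complex.exp ((h : ℝ) * z)) (𝓝[>] 0) (𝓝 1) := by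
    have : Continuous fun h : ℝ≥0 => Complex.exp ((h : ℝ) * z) := by fun_prop
    simpa using (this.tendsto 0).mono_left nhdsWithin_le_nhds
  have h2 := (h1.smul_const x).add (hc.smul h)
  rw [one_smul] at h2
  refine h2.congr fun h => ?_
  have he : Complex.exp ((h : ℝ) * z) * Complex.exp (-((h : ℝ) * z)) = 1 := by
    rw [← Complex.exp_add, add_neg_cancel, Complex.exp_zero]
  simp only [zero_add, Complex.ofReal_zero, zero_mul, Complex.exp_zero, rescaledSemigroup,
    smul_apply]
  rw [smul_comm (Complex.exp _) (_⁻¹), smul_eq_mul, mul_smul, ← smul_add, smul_sub (Complex.exp _),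
    smul_smul (Complex.exp _), he, one_smul, sub_smul, one_smul]
  congr 1
  abel

theorem isResolventAt_generator_iff {z : ℂ} {R : X →L[ℂ] X} :
    IsResolventAt (generator T) z R ↔
      (∀ x y, (x, y) ∈ generatorGraph T → R (z • x - y) = x) ∧
        ∀ y, (R y, z • R y - y) ∈ generatorGraph T := by
  have hg : (generator T).graph = generatorGraph T :=
    Submodule.toLinearPMap_graph_eq _ (generatorGraph_snd_eq_zero T)
  rw [← hg, IsResolventAt]
  refine and_congr ⟨fun h x y hxy => ?_, fun h x => h _ _ ((generator T).mem_graph x)⟩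
    ⟨fun h y => ?_, fun h y => ?_⟩
  · obtain ⟨w, rfl, rfl⟩ := (LinearPMap.mem_graph_iff _).1 hxy
    exact h w
  · obtain ⟨w, hw, hy⟩ := h y
    refine (LinearPMap.mem_graph_iff _).2 ⟨w, hw, ?_⟩
    rw [eq_sub_iff_add_eq, ← hw, add_comm]
    exact (sub_eq_iff_eq_add.1 hy).symm
  · obtain ⟨w, hw, hy⟩ := (LinearPMap.mem_graph_iff _).1 (h y)
    exact ⟨w, hw, by rw [hw, hy]; simp⟩

/-! ### Integrals of orbits and spectral inclusion -/

variable [CompleteSpace X]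

namespace IsC0Semigroup

theorem exists_norm_le (hT : IsC0Semigroup T) (b : ℝ≥0) : ∃ M, ∀ s ≤ b, ‖T s‖ ≤ M := by
  obtain ⟨M, hM⟩ := banach_steinhaus (g := fun s : Iic b => T s) fun x => by
    have hc : IsCompact (Iic b) := by
      rw [← Icc_bot]
      exact isCompact_Icc
    obtain ⟨C, hC⟩ := hc.exists_bound_of_continuousOn (hT.continuous_orbit x).continuousOn
    exact ⟨C, fun s => hC s s.2⟩
  exact ⟨M, fun s hs => hM ⟨s, hs⟩⟩

theorem exists_norm_integral_le (hT : IsC0Semigroup T) (b : ℝ) : ∃ M, ∀ r ≤ b, ∀ r' ≤ b, ∀ x,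
    ‖∫ s in r..r', T s.toNNReal x‖ ≤ M * |r' - r| * ‖x‖ := by
  obtain ⟨M, hM⟩ := hT.exists_norm_le b.toNNReal
  refine ⟨M, fun r hr r' hr' x => ?_⟩
  have : ‖∫ s in r..r', T s.toNNReal x‖ ≤ M * ‖x‖ * |r' - r| := by
    refine intervalIntegral.norm_integral_le_of_norm_le_const fun s hs => ?_
    refine (T s.toNNReal).le_of_opNorm_le (hM _ (Real.toNNReal_le_toNNReal ?_)) x
    exact hs.2.trans (max_le hr hr')
  linarith

/-- The bounded operator `x ↦ ∫₀^r T(s) x ds`. The semigroup is extended to negative times by the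
constant `T(0)`. -/
noncomputable def orbitIntegral (hT : IsC0Semigroup T) (r : ℝ) : X →L[ℂ] X :=
  LinearMap.mkContinuousOfExistsBound
    { toFun := fun x => ∫ s in (0 : ℝ)..r, T s.toNNReal x
      map_add' := fun x y => by
        rw [← intervalIntegral.integral_add
          ((hT.continuous_orbit_toNNReal x).intervalIntegrable _ _)
          ((hT.continuous_orbit_toNNReal y).intervalIntegrable _ _)]
        exact intervalIntegral.integral_congr fun s _ => _root_.map_add _ x y
      map_smul' := fun c x => by
        rw [RingHom.id_apply, ← intervalIntegral.integral_smul]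
        exact intervalIntegral.integral_congr fun s _ => map_smul _ c x }
    (by
      obtain ⟨M, hM⟩ := hT.exists_norm_integral_le (max 0 r)
      exact ⟨_, fun x => hM 0 (le_max_left _ _) r (le_max_right _ _) x⟩)

theorem orbitIntegral_apply (hT : IsC0Semigroup T) (r : ℝ) (x : X) :
    hT.orbitIntegral r x = ∫ s in (0 : ℝ)..r, T s.toNNReal x := rfl

theorem orbitIntegral_sub_apply (hT : IsC0Semigroup T) (r r' : ℝ) (x : X) :
    (hT.orbitIntegral r' - hT.orbitIntegral r) x = ∫ s in r..r', T s.toNNReal x := by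
  rw [sub_apply, orbitIntegral_apply, orbitIntegral_apply]
  exact intervalIntegral.integral_interval_sub_left
    ((hT.continuous_orbit_toNNReal x).intervalIntegrable _ _)
    ((hT.continuous_orbit_toNNReal x).intervalIntegrable _ _)

/-- Integrated orbits depend continuously on the time in the operator norm, although the orbits
themselves are only strongly continuous. -/
theorem continuous_orbitIntegral (hT : IsC0Semigroup T) : Continuous hT.orbitIntegral := by
  refine continuous_iff_continuousAt.2 fun r => ?_
  obtain ⟨M, hM⟩ := hT.exists_norm_integral_le (r + 1)
  have hM' : 0 ≤ max M 0 := le_max_right _ _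
  have h0 : Tendsto (fun r' : ℝ => max M 0 * |r' - r|) (𝓝 r) (𝓝 0) := by
    have : Continuous fun r' : ℝ => max M 0 * |r' - r| := by fun_prop
    simpa using this.tendsto r
  refine tendsto_iff_norm_sub_tendsto_zero.2 (squeeze_zero' (Eventually.of_forall fun _ =>
    norm_nonneg _) ?_ h0)
  filter_upwards [Iio_mem_nhds (lt_add_one r)] with r' hr'
  refine ContinuousLinearMap.opNorm_le_bound _ (by positivity) fun x => ?_
  rw [orbitIntegral_sub_apply]
  refine (hM r (by linarith) r' hr'.le x).trans ?_
  gcongr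
  exact le_max_left _ _

theorem apply_orbitIntegral (hT : IsC0Semigroup T) (s r : ℝ≥0) :
    T s * hT.orbitIntegral r = hT.orbitIntegral (s + r) - hT.orbitIntegral s := by
  ext x
  rw [orbitIntegral_sub_apply, mul_apply_eq_comp, orbitIntegral_apply,
    ← ContinuousLinearMap.intervalIntegral_comp_comm _
      ((hT.continuous_orbit_toNNReal x).intervalIntegrable _ _)]
  have h := intervalIntegral.integral_comp_add_left (a := 0) (b := r)
    (fun s : ℝ => T s.toNNReal x) (s : ℝ)
  rw [add_zero] at h
  rw [← h]
  refine intervalIntegral.integral_congr fun u hu => ?_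
  rw [uIcc_of_le r.coe_nonneg] at hu
  rw [Real.toNNReal_add s.coe_nonneg hu.1, hT.map_add, Real.toNNReal_coe, mul_apply_eq_comp]

theorem hasDerivAt_orbitIntegral (hT : IsC0Semigroup T) (x : X) (r : ℝ) :
    HasDerivAt (fun r => hT.orbitIntegral r x) (T r.toNNReal x) r :=
  intervalIntegral.integral_hasDerivAt_right
    ((hT.continuous_orbit_toNNReal x).intervalIntegrable _ _)
    (hT.continuous_orbit_toNNReal x).stronglyMeasurable.stronglyMeasurableAtFilter
    (hT.continuous_orbit_toNNReal x).continuousAt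

theorem commute_orbitIntegral (hT : IsC0Semigroup T) {B : X →L[ℂ] X}
    (hB : ∀ s, Commute B (T s)) (r : ℝ) : Commute B (hT.orbitIntegral r) := by
  ext x
  rw [mul_apply_eq_comp, mul_apply_eq_comp, orbitIntegral_apply,
    ← ContinuousLinearMap.intervalIntegral_comp_comm _
      ((hT.continuous_orbit_toNNReal x).intervalIntegrable _ _)]
  exact intervalIntegral.integral_congr fun u _ => congr($((hB u.toNNReal).eq) x)

theorem orbitIntegral_mem_generatorGraph (hT : IsC0Semigroup T) (r : ℝ≥0) (x : X) :
    (hT.orbitIntegral r x, T r x - x) ∈ generatorGraph T := by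
  have h1 := (hT.hasDerivAt_orbitIntegral x r).tendsto_slope_nnreal
  have h2 := (hT.hasDerivAt_orbitIntegral x 0).tendsto_slope_nnreal
  rw [Real.toNNReal_coe] at h1
  rw [Real.toNNReal_zero, hT.map_zero] at h2
  refine (h1.sub h2).congr fun h => ?_
  rw [← smul_sub]
  congr 1
  have := congr($(hT.apply_orbitIntegral h r) x)
  simp only [mul_apply_eq_comp, sub_apply] at this
  rw [this, add_comm (h : ℝ)]
  simp only [zero_add, orbitIntegral_apply hT 0, intervalIntegral.integral_same]
  abel

theorem tendsto_inv_smul_orbitIntegral (hT : IsC0Semigroup T) (x : X) :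
    Tendsto (fun h : ℝ≥0 => ((h : ℝ) : ℂ)⁻¹ • hT.orbitIntegral h x) (𝓝[>] 0) (𝓝 x) := by
  have h2 := (hT.hasDerivAt_orbitIntegral x 0).tendsto_slope_nnreal
  rw [Real.toNNReal_zero, hT.map_zero] at h2
  refine h2.congr fun h => ?_
  simp [orbitIntegral_apply hT 0]

/-- The identity `(z - A) ∫₀ᵗ e^{-zs} T(s) y ds = y - e^{-zt} T(t) y`. -/
theorem rescaled_orbitIntegral_mem_generatorGraph (hT : IsC0Semigroup T) (z : ℂ) (t : ℝ≥0)
    (y : X) :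
    ((hT.rescaled z).orbitIntegral t y,
      z • (hT.rescaled z).orbitIntegral t y - (1 - rescaledSemigroup T z t) y) ∈
        generatorGraph T := by
  have := generatorGraph_of_rescaled ((hT.rescaled z).orbitIntegral_mem_generatorGraph t y)
  have h1 : (1 - rescaledSemigroup T z t) y = -(rescaledSemigroup T z t y - y) := by simp
  rwa [h1, sub_neg_eq_add]

end IsC0Semigroup

/-- Spectral inclusion, valid for every `C₀`-semigroup: if `Q` inverts `1 - e^{-zt} T(t)`, then
`x ↦ Q ∫₀ᵗ e^{-zs} T(s) x ds` is a bounded inverse of `z - A`. -/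
theorem IsC0Semigroup.exp_mem_spectrum (hT : IsC0Semigroup T) {z : ℂ}
    (hz : z ∈ unboundedSpectrum (generator T)) (t : ℝ≥0) :
    Complex.exp ((t : ℝ) * z) ∈ spectrum ℂ (T t) := by
  intro hu
  apply hz
  set S := rescaledSemigroup T z with hSdef
  have hS : IsC0Semigroup S := hT.rescaled z
  have he : Complex.exp ((t : ℝ) * z) * Complex.exp (-((t : ℝ) * z)) = 1 := by
    rw [← Complex.exp_add, add_neg_cancel, Complex.exp_zero]
  have hu' : IsUnit (1 - S t) := by
    have h1 : algebraMap ℂ (X →L[ℂ] X) (Complex.exp ((t : ℝ) * z)) - T t =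
        Complex.exp ((t : ℝ) * z) • (1 - S t) := by
      rw [hSdef, rescaledSemigroup, smul_sub, smul_smul, he, one_smul, Algebra.algebraMap_eq_smul_one]
    have h2 : IsUnit (Complex.exp ((t : ℝ) * z) • (1 - S t)) := h1 ▸ hu
    have h3 := h2.smul (Units.mk0 (Complex.exp (-((t : ℝ) * z))) (Complex.exp_ne_zero _))
    rwa [Units.smul_def, Units.val_mk0, smul_smul, mul_comm, he, one_smul] at h3
  obtain ⟨U, hU⟩ := hu'
  set Q : X →L[ℂ] X := ↑U⁻¹
  have hQ1 : Q * (1 - S t) = 1 := by rw [← hU]; exact U.inv_mul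
  have hQS : ∀ s, Commute Q (S s) := fun s => by
    have : Commute (1 - S t) (S s) := (Commute.one_left _).sub_left (hS.commute t s)
    rw [← hU] at this
    exact this.units_inv_left
  have hQT : ∀ s, Commute Q (T s) := fun s => by
    have hTS : T s = Complex.exp ((s : ℝ) * z) • S s := by
      rw [hSdef, rescaledSemigroup, smul_smul, ← Complex.exp_add, add_neg_cancel, Complex.exp_zero,
        one_smul]
    rw [hTS]
    exact (hQS s).smul_right _
  set W := hS.orbitIntegral t
  have hWT : ∀ s, Commute W (T s) := fun s =>
    (hS.commute_orbitIntegral (fun r => (hT.commute s r).smul_right _) t).symm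
  have hWg : ∀ y, (W y, z • W y - (1 - S t) y) ∈ generatorGraph T :=
    hT.rescaled_orbitIntegral_mem_generatorGraph z t
  refine ⟨Q * W, isResolventAt_generator_iff.2 ⟨fun x y hxy => ?_, fun y => ?_⟩⟩
  · have h1 := generatorGraph_map_mem hWT hxy
    have h2 : W y = z • W x - (1 - S t) x :=
      sub_eq_zero.1 (generatorGraph_snd_eq_zero T _ (Submodule.sub_mem _ h1 (hWg x)) (by simp))
    rw [mul_apply_eq_comp, map_sub, map_smul, h2, sub_sub_cancel]
    exact congr($hQ1 x)
  · have h1 := generatorGraph_map_mem hQT (hWg y)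
    have h2 : Q ((1 - S t) y) = y := congr($hQ1 y)
    rwa [map_sub, map_smul, h2] at h1

end SemigroupCalculus

/-! ### Characters of commutative `C⋆`-algebras that contain the semigroup -/

section Characters

/-- A continuous multiplicative function on `[0, ∞)` is an exponential. Such a function is a
`C₀`-semigroup on `ℂ`, and its integrals supply the differentiability. -/
theorem exists_eq_exp_of_continuous_of_map_add {c : ℝ≥0 → ℂ} (hc : Continuous c) (h0 : c 0 = 1)
    (hadd : ∀ s t, c (s + t) = c s * c t) : ∃ z : ℂ, ∀ s, c s = Complex.exp ((s : ℝ) * z) := by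
  have hT : IsC0Semigroup fun s => c s • (1 : ℂ →L[ℂ] ℂ) :=
    { map_zero := by simp [h0]
      map_add := fun s t => by rw [hadd, smul_mul_smul_comm, one_mul]
      continuous_orbit := fun x => by
        simp only [smul_apply]
        fun_prop }
  obtain ⟨r, hr⟩ : ∃ r : ℝ≥0, hT.orbitIntegral r 1 ≠ 0 := by
    by_contra! h
    have := hT.tendsto_inv_smul_orbitIntegral 1
    simp only [h, smul_zero] at this
    exact one_ne_zero (tendsto_nhds_unique this tendsto_const_nhds)
  set I := hT.orbitIntegral r 1
  have hshift : ∀ s : ℝ≥0, c s * I = hT.orbitIntegral (s + r) 1 - hT.orbitIntegral s 1 := fun s =>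
    congr($(hT.apply_orbitIntegral s r) 1)
  have hF : ∀ s, HasDerivAt (fun s => hT.orbitIntegral s 1) (c s.toNNReal) s := fun s => by
    simpa using hT.hasDerivAt_orbitIntegral 1 s
  set z := (c r - 1) / I
  refine ⟨z, fun b => ?_⟩
  let g : ℝ → ℂ := fun s =>
    (hT.orbitIntegral (s + r) 1 - hT.orbitIntegral s 1) * Complex.exp (-(s * z))
  have hg : ∀ s : ℝ, HasDerivAt g
      ((c (s + r).toNNReal - c s.toNNReal) * Complex.exp (-(s * z)) +
        (hT.orbitIntegral (s + r) 1 - hT.orbitIntegral s 1) *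
          (Complex.exp (-(s * z)) * -z)) s := fun s => by
    refine (((hF (s + r)).comp_add_const s (r : ℝ)).sub (hF s)).mul ?_
    have := ((Complex.ofRealCLM.hasDerivAt (x := s)).mul_const z).neg.cexp
    simpa using this
  have hconst := constant_of_has_deriv_right_zero (f := g) (a := 0) (b := b)
    (fun s _ => (hg s).continuousAt.continuousWithinAt) (fun s hs => by
      convert (hg s).hasDerivWithinAt using 1
      lift s to ℝ≥0 using hs.1
      rw [← hshift, ← NNReal.coe_add, Real.toNNReal_coe, Real.toNNReal_coe, hadd]
      simp only [z]
      field_simp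
      ring) b ⟨b.coe_nonneg, le_rfl⟩
  have hgs : ∀ s : ℝ≥0, g s = c s * I * Complex.exp (-((s : ℝ) * z)) := fun s => by
    simp only [g, hshift]
  rw [hgs, ← NNReal.coe_zero, hgs, h0, NNReal.coe_zero, Complex.ofReal_zero, zero_mul, neg_zero,
    Complex.exp_zero, mul_one, one_mul, mul_right_comm, mul_eq_right₀ hr, Complex.exp_neg,
    mul_inv_eq_one₀ (Complex.exp_ne_zero _)] at hconst
  exact hconst

/-- A character that annihilates `b` has peak elements on which `b` is arbitrarily small. -/
theorem exists_character_eq_one_norm_mul_le {C : Type*} [CommCStarAlgebra C]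
    (χ : characterSpace ℂ C) {b : C} (hb : χ b = 0) {ε : ℝ} (hε : 0 < ε) :
    ∃ f : C, χ f = 1 ∧ ‖b * f‖ ≤ ε := by
  have hpos : ∀ x : ℝ, 0 < max ε x := fun x => hε.trans_le (le_max_left _ _)
  let φ : C(characterSpace ℂ C, ℂ) :=
    ⟨fun ψ => ((ε / max ε ‖gelfandTransform ℂ C b ψ‖ : ℝ) : ℂ), by
      refine Complex.continuous_ofReal.comp (Continuous.div₀ continuous_const ?_ fun ψ => (hpos _).ne')
      fun_prop⟩
  have hφ : ∀ ψ : characterSpace ℂ C,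
      ψ ((gelfandStarTransform C).symm φ) = ((ε / max ε ‖ψ b‖ : ℝ) : ℂ) := fun ψ =>
    congr($((gelfandStarTransform C).apply_symm_apply φ) ψ)
  refine ⟨(gelfandStarTransform C).symm φ, ?_, ?_⟩
  · rw [hφ, hb, norm_zero, max_eq_left hε.le, div_self hε.ne', Complex.ofReal_one]
  · rw [← (gelfandTransform_isometry C).norm_map_of_map_zero (map_zero _),
      ContinuousMap.norm_le _ hε.le]
    intro ψ
    have h1 : gelfandTransform ℂ C (b * (gelfandStarTransform C).symm φ) ψ =
        ψ b * ((ε / max ε ‖ψ b‖ : ℝ) : ℂ) := by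
      rw [← hφ, ← map_mul]
      rfl
    rw [h1, norm_mul, Complex.norm_real, Real.norm_of_nonneg (div_nonneg hε.le (hpos _).le),
      mul_div_assoc', div_le_iff₀ (hpos _), mul_comm]
    gcongr
    exact le_max_right _ _

variable {K : Type*} [NormedAddCommGroup K] [InnerProductSpace ℂ K] [CompleteSpace K]
  {T : ℝ≥0 → K →L[ℂ] K}

/-- A character that does not vanish on some integrated orbit `∫₀^r T(s) ds` is continuous along
the semigroup, hence given by an exponential `e^{sz}`. Then `z` lies in the spectrum of the
generator: with `N = ∫₀¹ e^{-zs} T(s) ds ∫₀^r T(s) ds`, a resolvent `R` at `z` would satisfy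
`N = R b` for an element `b` that the character annihilates, while it does not annihilate `N`. -/
theorem IsC0Semigroup.exists_mem_unboundedSpectrum_character {C : Type*} [CommCStarAlgebra C]
    {j : C →⋆ₐ[ℂ] (K →L[ℂ] K)} (hj : Function.Injective j) (hT : IsC0Semigroup T)
    {τ : ℝ≥0 → C} (hτ : ∀ s, j (τ s) = T s) {v : ℝ → C} (hv : ∀ r, j (v r) = hT.orbitIntegral r)
    (χ : characterSpace ℂ C) {r : ℝ≥0} (hχ : χ (v r) ≠ 0) :
    ∃ z ∈ unboundedSpectrum (generator T), ∀ s, χ (τ s) = Complex.exp ((s : ℝ) * z) := by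
  have hiso : Isometry j := NonUnitalStarAlgHom.isometry j hj
  have hnorm : ∀ a, ‖j a‖ = ‖a‖ := NonUnitalStarAlgHom.norm_map j hj
  have hvc : Continuous v := by
    rw [hiso.isEmbedding.continuous_iff]
    exact hT.continuous_orbitIntegral.congr fun r => (hv r).symm
  have hχc : Continuous χ := map_continuous χ
  have hmul : ∀ s : ℝ≥0, τ s * v r = v (s + r) - v s := fun s => hj (by
    rw [map_mul, map_sub, hτ, hv, hv, hv, hT.apply_orbitIntegral])
  have hχmul : ∀ s : ℝ≥0, χ (τ s) * χ (v r) = χ (v (s + r) - v s) := fun s => by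
    rw [← map_mul, hmul]
  obtain ⟨z, hz⟩ := exists_eq_exp_of_continuous_of_map_add (c := fun s => χ (τ s))
    (by
      have : (fun s => χ (τ s)) = fun s : ℝ≥0 => χ (v (s + r) - v s) / χ (v r) :=
        funext fun s => by rw [eq_div_iff hχ, hχmul]
      rw [this]
      fun_prop)
    (by
      have : τ 0 = 1 := hj (by rw [hτ, hT.map_zero, map_one])
      rw [this, map_one])
    (fun s t => by
      have : τ (s + t) = τ s * τ t := hj (by rw [map_mul, hτ, hτ, hτ, hT.map_add])
      rw [this, map_mul])
  refine ⟨z, ?_, hz⟩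
  rintro ⟨R, hR⟩
  rw [isResolventAt_generator_iff] at hR
  set u : ℝ → C := fun s => Complex.exp (-(s * z)) • (v (s + r) - v s) with hu
  have huc : Continuous u := by fun_prop
  set N : C := ∫ s in (0 : ℝ)..1, u s with hN
  have hχN : χ N = χ (v r) := by
    have h1 := (CharacterSpace.toCLM χ).intervalIntegral_comp_comm
      (huc.intervalIntegrable (μ := MeasureTheory.volume) 0 1)
    have h2 : ∀ s ∈ uIcc (0 : ℝ) 1, CharacterSpace.toCLM χ (u s) = χ (v r) := fun s hs => by
      rw [uIcc_of_le zero_le_one] at hs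
      lift s to ℝ≥0 using hs.1
      change χ (Complex.exp (-((s : ℝ) * z)) • (v (s + r) - v s)) = _
      rw [map_smul, ← hχmul, hz, smul_eq_mul, ← mul_assoc, ← Complex.exp_add, neg_add_cancel,
        Complex.exp_zero, one_mul]
    rw [intervalIntegral.integral_congr h2, intervalIntegral.integral_const, sub_zero,
      one_smul] at h1
    exact h1.symm
  have hjN : j N = (hT.rescaled z).orbitIntegral 1 * hT.orbitIntegral r := by
    ext x
    let L : C →L[ℂ] K := (ContinuousLinearMap.apply ℂ K x).comp
      (⟨(j : C →ₗ[ℂ] (K →L[ℂ] K)), hiso.continuous⟩ : C →L[ℂ] (K →L[ℂ] K))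
    have h1 := L.intervalIntegral_comp_comm (huc.intervalIntegrable (μ := MeasureTheory.volume) 0 1)
    have h2 : j N x = L N := rfl
    rw [h2, hN, ← h1, mul_apply_eq_comp, IsC0Semigroup.orbitIntegral_apply]
    refine intervalIntegral.integral_congr fun s hs => ?_
    rw [uIcc_of_le zero_le_one] at hs
    lift s to ℝ≥0 using hs.1
    have h3 : L (u s) = j (u s) x := rfl
    rw [h3, hu]
    simp only
    rw [← hmul, map_smul, map_mul, hτ, hv, Real.toNNReal_coe]
    rfl
  set b : C := v r - Complex.exp (-z) • (τ 1 * v r) with hb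
  have hχb : χ b = 0 := by
    rw [hb, map_sub, map_smul, map_mul, hz, smul_eq_mul, ← mul_assoc, ← Complex.exp_add]
    simp
  have hRb : j N = R * j b := by
    ext x
    have h1 := hR.1 _ _ (hT.rescaled_orbitIntegral_mem_generatorGraph z 1 (hT.orbitIntegral r x))
    rw [sub_sub_cancel, NNReal.coe_one] at h1
    rw [hjN, mul_apply_eq_comp, ← h1, mul_apply_eq_comp, hb, map_sub, map_smul, map_mul, hτ, hv]
    simp [rescaledSemigroup]
  have hpos : 0 < ‖χ (v r)‖ := norm_pos_iff.2 hχ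
  obtain ⟨f, hf, hbf⟩ := exists_character_eq_one_norm_mul_le χ hχb
    (ε := ‖χ (v r)‖ / (‖R‖ + 1)) (by positivity)
  have hle : ‖χ (v r)‖ ≤ ‖R‖ * (‖χ (v r)‖ / (‖R‖ + 1)) := by
    calc ‖χ (v r)‖ = ‖χ (N * f)‖ := by rw [map_mul, hf, mul_one, hχN]
      _ ≤ ‖N * f‖ := (ContinuousMap.norm_coe_le_norm (gelfandTransform ℂ C (N * f)) χ).trans_eq
          ((gelfandTransform_isometry C).norm_map_of_map_zero (_root_.map_zero _) _)
      _ = ‖R * j (b * f)‖ := by rw [← hnorm, map_mul, hRb, map_mul, mul_assoc]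
      _ ≤ ‖R‖ * ‖b * f‖ := (norm_mul_le _ _).trans_eq (by rw [hnorm])
      _ ≤ _ := by gcongr
  rw [mul_div_assoc', le_div_iff₀ (by positivity)] at hle
  linarith

/-- The characters that do not vanish on all integrated orbits are dense, since
`h⁻¹ ∫₀^h T(s) ds → 1` strongly as `h → 0`. So the spectrum of `T(t)` in a commutative `C⋆`-algebra
that contains the semigroup and its integrated orbits lies in the closure of the values at `T(t)`
of these characters. -/
theorem IsC0Semigroup.spectrum_subset_of_commCStarAlgebra {C : Type*} [CommCStarAlgebra C]
    {j : C →⋆ₐ[ℂ] (K →L[ℂ] K)} (hj : Function.Injective j) (hT : IsC0Semigroup T)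
    {τ : ℝ≥0 → C} (hτ : ∀ s, j (τ s) = T s) {v : ℝ → C} (hv : ∀ r, j (v r) = hT.orbitIntegral r)
    (t : ℝ≥0) : spectrum ℂ (τ t) ⊆
      closure ((fun z => Complex.exp ((t : ℝ) * z)) '' unboundedSpectrum (generator T)) := by
  intro μ hμ
  rw [CharacterSpace.mem_spectrum_iff_exists] at hμ
  obtain ⟨χ₀, rfl⟩ := hμ
  refine Metric.mem_closure_iff.2 fun ε hε => ?_
  by_contra! hfar
  -- a nonzero element whose Gelfand transform is supported where `χ (τ t)` is near `χ₀ (τ t)`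
  let φ : C(characterSpace ℂ C, ℂ) :=
    ⟨fun χ => ((max 0 (ε - dist (χ₀ (τ t)) (gelfandTransform ℂ C (τ t) χ)) : ℝ) : ℂ), by fun_prop⟩
  set a := (gelfandStarTransform C).symm φ
  have ha : ∀ χ : characterSpace ℂ C,
      χ a = ((max 0 (ε - dist (χ₀ (τ t)) (χ (τ t))) : ℝ) : ℂ) := fun χ =>
    congr($((gelfandStarTransform C).apply_symm_apply φ) χ)
  have hav : ∀ r : ℝ≥0, a * v r = 0 := fun r => by
    refine (gelfandTransform_isometry C).injective (ContinuousMap.ext fun χ => ?_)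
    rw [_root_.map_zero, ContinuousMap.zero_apply]
    have : gelfandTransform ℂ C (a * v r) χ = χ a * χ (v r) := map_mul χ _ _
    rw [this, mul_eq_zero, or_iff_not_imp_right]
    intro hχ
    obtain ⟨z, hz, hzs⟩ := hT.exists_mem_unboundedSpectrum_character hj hτ hv χ hχ
    rw [ha, hzs t, max_eq_left (sub_nonpos.2 (hfar _ ⟨z, hz, rfl⟩)), Complex.ofReal_zero]
  have ha0 : a = 0 := hj (by
    rw [_root_.map_zero]
    ext x
    have h1 := ((j a).continuous.tendsto x).comp (hT.tendsto_inv_smul_orbitIntegral x)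
    refine tendsto_nhds_unique h1 (tendsto_const_nhds.congr fun h => ?_)
    have h2 : j a (hT.orbitIntegral h x) = 0 := by
      rw [← hv, ← mul_apply_eq_comp, ← map_mul, hav, _root_.map_zero, zero_apply]
    rw [Function.comp_apply, map_smul, h2, smul_zero, zero_apply])
  have h3 := ha χ₀
  rw [ha0, _root_.map_zero, dist_self, sub_zero, max_eq_right hε.le, eq_comm, Complex.ofReal_eq_zero] at h3
  exact hε.ne' h3

end Characters

/-! ### Commutative star-subalgebras generated by commuting normal elements -/

section CStarSubalgebras

variable {A : Type*} [CStarAlgebra A]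

theorem isClosed_cstarGenerated (S : Set A) : IsClosed (cstarGenerated S : Set A) :=
  StarSubalgebra.isClosed_topologicalClosure _

theorem subset_cstarGenerated (S : Set A) : S ⊆ cstarGenerated S :=
  (StarAlgebra.subset_adjoin ℂ S).trans (StarSubalgebra.le_topologicalClosure _)

theorem cstarGenerated_le {S : Set A} {B : StarSubalgebra ℂ A} (hB : IsClosed (B : Set A))
    (h : S ⊆ B) : cstarGenerated S ≤ B :=
  StarSubalgebra.topologicalClosure_minimal (StarAlgebra.adjoin_le h) hB

/-- By Fuglede's theorem, commuting normal elements also commute with each other's adjoints, so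
their bicommutant is commutative. -/
theorem commute_of_mem_bicommutant {S : Set A} (hS : ∀ a ∈ S, ∀ b ∈ S, Commute a b)
    (hn : ∀ a ∈ S, IsStarNormal a) {a b : A}
    (ha : a ∈ StarSubalgebra.centralizer ℂ (StarSubalgebra.centralizer ℂ S : Set A))
    (hb : b ∈ StarSubalgebra.centralizer ℂ (StarSubalgebra.centralizer ℂ S : Set A)) :
    a * b = b * a := by
  rw [← SetLike.mem_coe, StarSubalgebra.coe_centralizer_centralizer] at ha hb
  refine Set.centralizer_centralizer_comm_of_comm (fun x hx y hy => ?_) _ ha _ hb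
  rcases hx with hx | hx <;> rcases hy with hy | hy
  · exact hS x hx y hy
  · have := (hn _ hy).commute_star_right (hS x hx _ hy)
    rwa [star_star] at this
  · have := (hn _ hx).commute_star_left (hS _ hx y hy)
    rwa [star_star] at this
  · have := (hS _ hx _ hy).star_star
    rwa [star_star, star_star] at this

theorem commute_of_mem_cstarGenerated {S : Set A} (hS : ∀ a ∈ S, ∀ b ∈ S, Commute a b)
    (hn : ∀ a ∈ S, IsStarNormal a) {a b : A} (ha : a ∈ cstarGenerated S)
    (hb : b ∈ cstarGenerated S) : a * b = b * a :=
  commute_of_mem_bicommutant hS hn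
    (StarSubalgebra.topologicalClosure_adjoin_le_centralizer_centralizer ℂ S ha)
    (StarSubalgebra.topologicalClosure_adjoin_le_centralizer_centralizer ℂ S hb)

/-- The commutative `C⋆`-algebra structure on a closed star-subalgebra whose elements commute. -/
noncomputable abbrev StarSubalgebra.commCStarAlgebraOfCommute (B : StarSubalgebra ℂ A)
    (hB : IsClosed (B : Set A)) (hc : ∀ a ∈ B, ∀ b ∈ B, a * b = b * a) : CommCStarAlgebra B :=
  { StarSubalgebra.cstarAlgebra B (h_closed := hB) with
    mul_comm := fun a b => Subtype.ext (hc a a.2 b b.2) }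

theorem StarAlgHom.spectrum_map_of_injective {B : Type*} [CStarAlgebra B] (φ : A →⋆ₐ[ℂ] B)
    (hφ : Function.Injective φ) (a : A) : spectrum ℂ (φ a) = spectrum ℂ a := by
  have hcl : IsClosed (φ.range : Set B) := by
    exact (NonUnitalStarAlgHom.isometry φ hφ).isClosedEmbedding.isClosed_range
  have h := StarSubalgebra.spectrum_eq φ.range (hS := hcl) (a := StarAlgEquiv.ofInjective φ hφ a)
  exact h.symm.trans (AlgEquiv.spectrum_eq (StarAlgEquiv.ofInjective φ hφ) a)

theorem characterSpace_cstarGenerated_ext {S : Set A} {χ ψ : characterSpace ℂ (cstarGenerated S)}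
    (h : ∀ x (hx : x ∈ S), χ ⟨x, subset_cstarGenerated S hx⟩ = ψ ⟨x, subset_cstarGenerated S hx⟩) :
    χ = ψ := by
  have : IsClosed (cstarGenerated S : Set A) := isClosed_cstarGenerated S
  have key : ∀ x (hx : x ∈ StarAlgebra.adjoin ℂ S),
      χ ⟨x, StarSubalgebra.le_topologicalClosure _ hx⟩ =
        ψ ⟨x, StarSubalgebra.le_topologicalClosure _ hx⟩ := fun x hx => by
    induction hx using StarAlgebra.adjoin_induction with
    | mem x hx => exact h x hx
    | algebraMap r => exact (AlgHomClass.commutes χ r).trans (AlgHomClass.commutes ψ r).symm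
    | add x y hx hy ihx ihy =>
      have := congr($ihx + $ihy)
      rwa [← map_add, ← map_add] at this
    | mul x y hx hy ihx ihy =>
      have := congr($ihx * $ihy)
      rwa [← map_mul, ← map_mul] at this
    | star x hx ihx =>
      have := congr(star $ihx)
      rwa [← map_star, ← map_star] at this
  refine DFunLike.coe_injective (Continuous.ext_on
    (s := Set.range (Set.inclusion (StarSubalgebra.le_topologicalClosure (StarAlgebra.adjoin ℂ S))))
    ?_ (map_continuous χ) (map_continuous ψ) ?_)
  · change DenseRange _
    exact denseRange_inclusion_iff (StarSubalgebra.le_topologicalClosure _) |>.2 subset_rfl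
  · rintro _ ⟨x, rfl⟩
    exact key x x.2

end CStarSubalgebras

/-! ### The spectral mapping theorem for normal semigroups -/

theorem IsC0Semigroup.spectrum_eq_closure_exp {K : Type*} [NormedAddCommGroup K]
    [InnerProductSpace ℂ K] [CompleteSpace K] {T : ℝ≥0 → K →L[ℂ] K} (hT : IsC0Semigroup T)
    (hn : ∀ t, IsStarNormal (T t)) (t : ℝ≥0) :
    spectrum ℂ (T t) =
      closure ((fun z => Complex.exp ((t : ℝ) * z)) '' unboundedSpectrum (generator T)) := by
  refine Subset.antisymm ?_ (closure_minimal ?_ (spectrum.isClosed _))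
  · -- The bicommutant contains the integrated orbits, which need not lie in the norm-closed
    -- algebra generated by the semigroup.
    set C := StarSubalgebra.centralizer ℂ
      (StarSubalgebra.centralizer ℂ (Set.range T) : Set (K →L[ℂ] K)) with hC
    have hcl : IsClosed (C : Set (K →L[ℂ] K)) := Set.isClosed_centralizer _
    have hcomm : ∀ a ∈ C, ∀ b ∈ C, a * b = b * a := fun a ha b hb =>
      commute_of_mem_bicommutant (S := Set.range T)
        (by rintro _ ⟨s, rfl⟩ _ ⟨r, rfl⟩; exact hT.commute s r)
        (by rintro _ ⟨s, rfl⟩; exact hn s) ha hb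
    have hmem : ∀ a, a ∈ C ↔ a ∈ (Set.range T ∪ star (Set.range T)).centralizer.centralizer :=
      fun a => by rw [← SetLike.mem_coe, hC, StarSubalgebra.coe_centralizer_centralizer]
    have hτ : ∀ s, T s ∈ C := fun s =>
      (hmem _).2 (Set.subset_centralizer_centralizer (Or.inl ⟨s, rfl⟩))
    have hv : ∀ r, hT.orbitIntegral r ∈ C := fun r => (hmem _).2 fun B hB =>
      hT.commute_orbitIntegral (fun s => (hB (T s) (Or.inl ⟨s, rfl⟩)).symm) r
    let _ := C.commCStarAlgebraOfCommute hcl hcomm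
    have h := hT.spectrum_subset_of_commCStarAlgebra (C := C) (j := C.subtype)
      Subtype.val_injective (τ := fun s => ⟨T s, hτ s⟩) (fun _ => rfl)
      (v := fun r => ⟨hT.orbitIntegral r, hv r⟩) (fun _ => rfl) t
    rwa [StarSubalgebra.spectrum_eq C (hS := hcl)] at h
  · rintro _ ⟨z, hz, rfl⟩
    exact hT.exp_mem_spectrum hz t

/-! ### The character space as an inverse limit -/

/-- Evaluation at the `d n` is a homeomorphism onto the inverse limit; a preimage of a given point
exists because the characters with prescribed values form a decreasing sequence of compact sets. -/
theorem nonempty_homeomorph_inverseLimit {D : Type*} [CommCStarAlgebra D] {d : ℕ → D} {S : Set ℂ}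
    (hsep : ∀ χ ψ : characterSpace ℂ D, (∀ n, χ (d n) = ψ (d n)) → χ = ψ)
    (hsq : ∀ n, d (n + 1) ^ 2 = d n) (hspec : ∀ n, spectrum ℂ (d n) = expClosure S n) :
    Nonempty (characterSpace ℂ D ≃ₜ InverseLimit (fun n => expClosure S n) (sqMap S)) := by
  have hval : ∀ (χ : characterSpace ℂ D) n, χ (d n) ∈ expClosure S n := fun χ n =>
    hspec n ▸ AlgHom.apply_mem_spectrum χ (d n)
  have hχsq : ∀ (χ : characterSpace ℂ D) n, χ (d (n + 1)) ^ 2 = χ (d n) := fun χ n => by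
    rw [← map_pow, hsq]
  have hcont : ∀ n, Continuous fun χ : characterSpace ℂ D => χ (d n) := fun n =>
    (gelfandTransform ℂ D (d n)).continuous
  let Φ : characterSpace ℂ D → InverseLimit (fun n => expClosure S n) (sqMap S) := fun χ =>
    ⟨fun n => ⟨χ (d n), hval χ n⟩, fun n => Subtype.ext (hχsq χ n)⟩
  have hΦ : Continuous Φ :=
    Continuous.subtype_mk (continuous_pi fun n => (hcont n).subtype_mk (hval · n)) _
  have hbij : Function.Bijective Φ := by
    refine ⟨fun χ ψ h => hsep χ ψ fun n => ?_, fun x => ?_⟩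
    · exact congr((($h).1 n : ℂ))
    · have hx : ∀ n, (x.1 (n + 1) : ℂ) ^ 2 = x.1 n := fun n => congr(($(x.2 n) : ℂ))
      have hcl : ∀ n, IsClosed {χ : characterSpace ℂ D | χ (d n) = x.1 n} := fun n =>
        isClosed_eq (hcont n) continuous_const
      obtain ⟨χ, hχ⟩ := IsCompact.nonempty_iInter_of_sequence_nonempty_isCompact_isClosed
        (fun n => {χ : characterSpace ℂ D | χ (d n) = x.1 n})
        (fun n χ hχ => by
          have hχ' : χ (d (n + 1)) = x.1 (n + 1) := hχ
          change χ (d n) = x.1 n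
          rw [← hχsq, hχ', hx])
        (fun n => CharacterSpace.mem_spectrum_iff_exists.1 ((hspec n).symm ▸ (x.1 n).2))
        (hcl 0).isCompact hcl
      exact ⟨χ, Subtype.ext (funext fun n => Subtype.ext (mem_iInter.1 hχ n))⟩
  exact ⟨hΦ.homeoOfEquivCompactToT2 (f := Equiv.ofBijective Φ hbij)⟩

/-! ### Preimages in `ℬ(H)` of subalgebras of the Calkin algebra -/

section Extension

variable {H : Type*} [NormedAddCommGroup H] [InnerProductSpace ℂ H] [CompleteSpace H]

theorem Calkin.continuous_mk : Continuous (Calkin.mk H) :=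
  AddMonoidHomClass.continuous_of_bound (Calkin.mk H) 1 fun T =>
    (Calkin.norm_mkAlg_le T).trans_eq (one_mul _).symm

theorem Calkin.mk_surjective : Function.Surjective (Calkin.mk H) := Calkin.mkAlg_surjective

theorem Calkin.mk_eq_zero {S : H →L[ℂ] H} : Calkin.mk H S = 0 ↔ S ∈ compactOps H :=
  Calkin.mkAlg_eq_zero

theorem comap_mk_cstarGenerated {S : Set (Calkin H)} (h1 : 1 ∈ S) :
    (cstarGenerated S).comap (Calkin.mk H) = cstarGenerated (Calkin.mk H ⁻¹' S) := by
  refine le_antisymm (fun R hR => ?_) (cstarGenerated_le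
    ((isClosed_cstarGenerated S).preimage Calkin.continuous_mk) fun R hR =>
      subset_cstarGenerated S hR)
  set B := cstarGenerated (Calkin.mk H ⁻¹' S)
  -- a compact operator is a difference of two lifts of `1`
  have hK : ∀ C ∈ compactOps H, C ∈ B := fun C hC => by
    have h2 : 1 + C ∈ B := subset_cstarGenerated _ (by
      rw [mem_preimage, map_add, map_one, Calkin.mk_eq_zero.2 hC, add_zero]
      exact h1)
    simpa using sub_mem h2 (one_mem B)
  have hadj : StarAlgebra.adjoin ℂ S ≤ B.map (Calkin.mk H) := by
    refine StarAlgebra.adjoin_le fun a ha => ?_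
    obtain ⟨R, rfl⟩ := Calkin.mk_surjective a
    exact ⟨R, subset_cstarGenerated _ ha, rfl⟩
  have hR' : Calkin.mk H R ∈ closure (StarAlgebra.adjoin ℂ S : Set (Calkin H)) := hR
  have hclosed : IsClosed (B : Set (H →L[ℂ] H)) := isClosed_cstarGenerated _
  rw [← SetLike.mem_coe, ← hclosed.closure_eq]
  refine Metric.mem_closure_iff.2 fun ε hε => ?_
  obtain ⟨a, ha, hRa⟩ := Metric.mem_closure_iff.1 hR' ε hε
  obtain ⟨R', hR'B, hR'a⟩ := hadj ha
  replace hR'a : Calkin.mk H R' = a := hR'a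
  subst hR'a
  rw [dist_eq_norm] at hRa
  obtain ⟨V, hV, hVn⟩ := Calkin.exists_norm_lt (Calkin.mk H R - Calkin.mk H R') (sub_pos.2 hRa)
  rw [add_sub_cancel] at hVn
  refine ⟨R - V, ?_, by rwa [dist_eq_norm, sub_sub_cancel]⟩
  have hC : R - V - R' ∈ compactOps H := by
    have hV' : Calkin.mk H V = Calkin.mk H R - Calkin.mk H R' := hV
    rw [← Calkin.mk_eq_zero, map_sub, map_sub, hV', sub_sub_cancel, sub_self]
  simpa using add_mem (hK _ hC) hR'B

end Extension

/-! ### The extension by the compact operators -/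

theorem proposition3p1
    -- `H` is an infinite-dimensional separable Hilbert space
    {H : Type*} [NormedAddCommGroup H] [InnerProductSpace ℂ H] [CompleteSpace H]
    [TopologicalSpace.SeparableSpace H] (hH : ¬ FiniteDimensional ℂ H)
    -- `γ` is a faithful representation of the Calkin algebra on a Hilbert space `K`
    {K : Type*} [NormedAddCommGroup K] [InnerProductSpace ℂ K] [CompleteSpace K]
    (γ : Calkin H →⋆ₐ[ℂ] (K →L[ℂ] K)) (hγ : Function.Injective γ)
    -- `T` is a `C₀`-semigroup of normal operators that represents `(q(t))_{t ∈ D}`, where `D` is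
    -- `[0, ∞)` or the set of dyadic rationals
    (D : Set ℝ≥0) (hD : D = Set.univ ∨ D = dyadicTimes)
    (q : ℝ≥0 → Calkin H) (T : ℝ≥0 → K →L[ℂ] K) (hqT : ∀ t ∈ D, γ (q t) = T t)
    (hT : IsC0Semigroup T) (hnormal : ∀ t, IsStarNormal (T t))
    -- the C⋆-algebra `𝒜₀` generated by `1` and all `q(2^{-n})`, and `ℰ = π⁻¹(𝒜₀)`
    (A₀ : StarSubalgebra ℂ (Calkin H))
    (hA₀ : A₀ = cstarGenerated (insert 1 (Set.range fun n : ℕ => q ((2 : ℝ≥0)⁻¹ ^ n))))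
    (E : StarSubalgebra ℂ (H →L[ℂ] H)) (hE : E = A₀.comap (Calkin.mk H)) :
    -- `ℰ` is the C⋆-algebra generated by all lifts of `1` and of the `q(2^{-n})`
    E = cstarGenerated
        (Calkin.mk H ⁻¹' insert 1 (Set.range fun n : ℕ => q ((2 : ℝ≥0)⁻¹ ^ n))) ∧
    -- (a)
    (∀ a ∈ A₀, ∀ b ∈ A₀, a * b = b * a) ∧
    Nonempty (characterSpace ℂ A₀ ≃ₜ
      InverseLimit (fun n => expClosure (unboundedSpectrum (generator T)) n)
        (sqMap (unboundedSpectrum (generator T)))) ∧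
    -- (b)
    (∀ S ∈ E, ∀ C ∈ compactOps H, C ∈ E ∧ S * C ∈ compactOps H ∧ C * S ∈ compactOps H) ∧
    ∃ (ι : compactOps H →⋆ₙₐ[ℂ] E) (θ : E →⋆ₐ[ℂ] C(characterSpace ℂ A₀, ℂ)),
      (∀ C, (ι C : H →L[ℂ] H) = C) ∧
      (∀ (S : E) (a : A₀), (a : Calkin H) = Calkin.mk H S →
        θ S = gelfandTransform ℂ A₀ a) ∧
      Function.Injective ι ∧ Function.Exact ι θ ∧ Function.Surjective θ := by
  set S : Set (Calkin H) := insert 1 (Set.range fun n : ℕ => q ((2 : ℝ≥0)⁻¹ ^ n))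
  have hD' : ∀ n : ℕ, (2 : ℝ≥0)⁻¹ ^ n ∈ D := fun n => by
    rcases hD with rfl | rfl
    · trivial
    · exact ⟨1, n, by rw [Nat.cast_one, one_div, inv_pow]⟩
  have hγq : ∀ n : ℕ, γ (q ((2 : ℝ≥0)⁻¹ ^ n)) = T ((2 : ℝ≥0)⁻¹ ^ n) := fun n => hqT _ (hD' n)
  have hScomm : ∀ a ∈ S, ∀ b ∈ S, Commute a b := by
    rintro _ (rfl | ⟨n, rfl⟩) _ (rfl | ⟨m, rfl⟩)
    · exact Commute.one_left 1
    · exact Commute.one_left _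
    · exact Commute.one_right _
    · refine hγ ?_
      simp only [map_mul, hγq]
      exact hT.commute _ _
  have hSn : ∀ a ∈ S, IsStarNormal a := by
    rintro _ (rfl | ⟨n, rfl⟩)
    · infer_instance
    · refine ⟨hγ ?_⟩
      simp only [map_mul, map_star, hγq]
      exact (hnormal _).star_comm_self
  have hcomm : ∀ a ∈ A₀, ∀ b ∈ A₀, a * b = b * a := fun a ha b hb =>
    commute_of_mem_cstarGenerated hScomm hSn (hA₀ ▸ ha) (hA₀ ▸ hb)
  have hcl : IsClosed (A₀ : Set (Calkin H)) := hA₀ ▸ isClosed_cstarGenerated S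
  have hqA : ∀ n : ℕ, q ((2 : ℝ≥0)⁻¹ ^ n) ∈ A₀ := fun n =>
    hA₀ ▸ subset_cstarGenerated S (Or.inr ⟨n, rfl⟩)
  have hKE : ∀ C ∈ compactOps H, C ∈ E := fun C hC => by
    rw [hE, StarSubalgebra.mem_comap, Calkin.mk_eq_zero.2 hC]
    exact zero_mem A₀
  let _ : CommCStarAlgebra A₀ := A₀.commCStarAlgebraOfCommute hcl hcomm
  refine ⟨?_, hcomm, ?_, fun R hR C hC => ⟨hKE C hC, ?_, ?_⟩, ?_⟩
  · rw [hE, hA₀, comap_mk_cstarGenerated (Set.mem_insert 1 _)]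
  · refine nonempty_homeomorph_inverseLimit (D := A₀) (d := fun n => ⟨_, hqA n⟩) ?_ ?_ ?_
    · subst hA₀
      refine fun χ ψ h => characterSpace_cstarGenerated_ext ?_
      rintro _ (rfl | ⟨n, rfl⟩)
      · exact (map_one χ).trans (map_one ψ).symm
      · exact h n
    · refine fun n => Subtype.ext (hγ ?_)
      change γ (q _ ^ 2) = γ (q _)
      rw [map_pow, hγq, hγq, hT.pow_eq, pow_succ']
      congr 1
      rw [← mul_assoc, Nat.cast_ofNat, mul_inv_cancel₀ two_ne_zero, one_mul]
    · intro n
      rw [StarSubalgebra.spectrum_eq A₀ (hS := hcl), ← γ.spectrum_map_of_injective hγ, hγq,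
        hT.spectrum_eq_closure_exp hnormal, expClosure]
      congr 2
      ext z
      push_cast
      rw [inv_pow, inv_mul_eq_div]
  · exact hC.clm_comp R
  · exact hC.comp_clm R
  · let ι : compactOps H →⋆ₙₐ[ℂ] E :=
      { toFun := fun C => ⟨C, hKE C C.2⟩
        map_smul' := fun _ _ => rfl
        map_zero' := rfl
        map_add' := fun _ _ => rfl
        map_mul' := fun _ _ => rfl
        map_star' := fun _ => rfl }
    have hEA : ∀ R : E, (Calkin.mk H).comp E.subtype R ∈ A₀ := fun R => hE.le R.2
    let ρ : E →⋆ₐ[ℂ] A₀ := ((Calkin.mk H).comp E.subtype).codRestrict A₀ hEA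
    let θ : E →⋆ₐ[ℂ] C(characterSpace ℂ A₀, ℂ) :=
      (gelfandStarTransform A₀ : A₀ →⋆ₐ[ℂ] C(characterSpace ℂ A₀, ℂ)).comp ρ
    have hθ : ∀ R, θ R = gelfandStarTransform A₀ (ρ R) := fun _ => rfl
    refine ⟨ι, θ, fun _ => rfl, fun R a ha => ?_, fun C C' h => ?_, fun R => ?_, fun f => ?_⟩
    · rw [hθ, show ρ R = a from Subtype.ext ha.symm]
      rfl
    · exact Subtype.ext congr(($h : H →L[ℂ] H))
    · rw [hθ, EmbeddingLike.map_eq_zero_iff, ← ZeroMemClass.coe_eq_zero]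
      refine Calkin.mk_eq_zero.trans ⟨fun h => ⟨⟨R, h⟩, rfl⟩, ?_⟩
      rintro ⟨C, rfl⟩
      exact C.2
    · obtain ⟨a, rfl⟩ := (gelfandStarTransform A₀).surjective f
      obtain ⟨R, hR⟩ := Calkin.mk_surjective (a : Calkin H)
      refine ⟨⟨R, ?_⟩, ?_⟩
      · rw [hE, StarSubalgebra.mem_comap, hR]
        exact a.2
      · rw [hθ]
        exact congrArg _ (Subtype.ext hR)
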